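/- For $a\in(0,1/2]$ and $r\in(0,1)$ put $r'=\sqrt{1-r^2}$ and $$\mathcal K_a(r)=\frac{\pi}{2}\,{}_2F_1(a,1-a;1;r^2),\qquad \mu_a(r)=\frac{\pi}{2\sin(\pi a)}\frac{\mathcal K_a(r')}{\mathcal K_a(r)},\qquad m_a(r)=\frac{2}{\pi\sin(\pi a)}\,r'^2\,\mathcal K_a(r')\,\mathcal K_a(r),$$ where ${}_2F_1$ is the Gaussian hypergeometric function. The function $\mu_a$ is a strictly decreasing bijection from $(0,1)$ onto $(0,\infty)$, and for $K\in(0,\infty)$ we put $\varphi_K^a(r)=\mu_a^{-1}(\mu_a(r)/K)$. Theorem 6. Let $\xi(a,r)$ and $\rho(a,r)$ be real functions on $(0,1/2]\times(0,1)$. Fix $(a,r)\in(0,1/2]\times(0,1)$ and $p\in(0,\infty)$, and for $K\in(0,\infty)$ define $$g_6(K)=\frac{\varphi_K^a(r)^p\,\bigl(e^{\xi(a,r)}\bigr)^{1/K}}{\varphi_K^a(r^p)},\qquad g_7(K)=\frac{\varphi_{1/K}^a(r)^p\,\bigl(e^{\rho(a,r)}\bigr)^{K}}{\varphi_{1/K}^a(r^p)}.$$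 Then the following statements hold. (1) If $0<p<1$, then $g_6$ is strictly increasing on $(0,1]$ if and only if $\xi(a,r)\le p\mu_a(r)-\mu_a(r^p)$; it is strictly decreasing on $(0,1]$ if and only if $\xi(a,r)\ge p\,m_a(r)-m_a(r^p)$; and it is strictly increasing on $[1,\infty)$ if and only if $\xi(a,r)\le p\,m_a(r)-m_a(r^p)$. If $p>1$, then $g_6$ is strictly increasing on $(0,1]$ if and only if $\xi(a,r)\le p\,m_a(r)-m_a(r^p)$; it is strictly decreasing on $(0,1]$ if and only if $\xi(a,r)\ge p\mu_a(r)-\mu_a(r^p)$; and it is strictly decreasing on $[1,\infty)$ if and only if $\xi(a,r)\ge p\,m_a(r)-m_a(r^p)$. (2) If $0<p<1$, then $g_7$ is strictly decreasing on $(0,1]$ if and only if $\rho(a,r)\le p\,m_a(r)-m_a(r^p)$; it is strictly increasing on $[1,\infty)$ if and only if $\rho(a,r)\ge p\,m_a(r)-m_a(r^p)$; and it is strictly decreasing on $[1,\infty)$ if and only if $\rho(a,r)\le p\mu_a(r)-\mu_a(r^p)$. If $p>1$, then $g_7$ is strictly increasing on $(0,1]$ if and only if $\rho(a,r)\ge p\,m_a(r)-m_a(r^p)$;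 it is strictly increasing on $[1,\infty)$ if and only if $\rho(a,r)\ge p\mu_a(r)-\mu_a(r^p)$; and it is strictly decreasing on $[1,\infty)$ if and only if $\rho(a,r)\le p\,m_a(r)-m_a(r^p)$. If $p=1$, then all the statements made in (1) and (2) for $0<p<1$ hold with $\le$ and $\ge$ replaced by $<$ and $>$, respectively. -/

import Mathlib

open Set

noncomputable section

/-- The generalized complete elliptic integral of the first kind,
`K_a(r) = (π / 2) F(a, 1 - a; 1; r ^ 2)`, for `a ∈ (0, 1)` and `r ∈ (0, 1)`. -/
def genEllipticK (a r : ℝ) : ℝ :=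
  Real.pi / 2 * ordinaryHypergeometric a (1 - a) (1 : ℝ) (r ^ 2)

/-- The complementary modulus `r' = √(1 - r ^ 2)`. -/
def compModulus (r : ℝ) : ℝ := Real.sqrt (1 - r ^ 2)

/-- The generalized Grötzsch ring function
`μ_a(r) = π / (2 sin (π a)) * K_a(r') / K_a(r)`, for `r ∈ (0, 1)`. -/
def genMu (a r : ℝ) : ℝ :=
  Real.pi / (2 * Real.sin (Real.pi * a)) *
    (genEllipticK a (compModulus r) / genEllipticK a r)

/-- The function `m_a(r) = 2 / (π sin (π a)) * r' ^ 2 * K_a(r') * K_a(r)`, for `r ∈ (0, 1)`. -/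
def genM (a r : ℝ) : ℝ :=
  2 / (Real.pi * Real.sin (Real.pi * a)) *
    (compModulus r) ^ 2 * genEllipticK a (compModulus r) * genEllipticK a r

/-- The generalized Hersch-Pfluger distortion function `φ_K^a(r) = μ_a⁻¹ (μ_a(r) / K)`, for
`r ∈ (0, 1)` and `K ∈ (0, ∞)`, where `μ_a⁻¹` is the inverse of `μ_a : (0, 1) → (0, ∞)`. -/
def genPhi (a K r : ℝ) : ℝ :=
  Function.invFunOn (genMu a) (Ioo (0 : ℝ) 1) (genMu a r / K)

/-- `g_6(K) = φ_K^a(r) ^ p * (e ^ ξ(a, r)) ^ (1 / K) / φ_K^a(r ^ p)`. -/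
def gSix (ξ : ℝ → ℝ → ℝ) (a r p K : ℝ) : ℝ :=
  genPhi a K r ^ p * Real.exp (ξ a r) ^ (1 / K) / genPhi a K (r ^ p)

/-- `g_7(K) = φ_{1/K}^a(r) ^ p * (e ^ ρ(a, r)) ^ K / φ_{1/K}^a(r ^ p)`. -/
def gSeven (ρ : ℝ → ℝ → ℝ) (a r p K : ℝ) : ℝ :=
  genPhi a (1 / K) r ^ p * Real.exp (ρ a r) ^ K / genPhi a (1 / K) (r ^ p)

end

/-!
In the variable `x = r ^ 2`, write `F(x) = ₂F₁(a, 1 - a; 1; x)` and `B(x) = (1 - x) F'(x)`. The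
Wronskian of `F(x)` and `F(1 - x)` is constant (`legendre_relation`), its value `sin (π a) / π`
coming from Abel's limit theorem and Euler's formula for `Γ`. It gives `dμ_a / dx = -1 / (2 x h)`
with `h = (1 - x) F ^ 2 = m_a / μ_a`, so `σ = -log μ_a⁻¹` satisfies `σ'(y) = η(y)`, where `η(y)`
is the value of `h` at the point with `μ_a = y`. With `Y = μ_a(r)` and `Y' = μ_a(r ^ p)`, so that
`σ(Y') = p σ(Y)`,

  `log g₇(u) = ρ u - p σ(Y u) + σ(Y' u)`, with derivative `ρ - G(u)`,
  `G(u) = p Y η(Y u) - Y' η(Y' u)`.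

Here `G(1) = p m_a(r) - m_a(r ^ p)` and `G(u) → p μ_a(r) - μ_a(r ^ p)` at infinity, because
`η → 1`. Everything thus reduces to the position of `G(u)` relative to these two numbers.

The decisive fact is that the elasticity `D(y) = y η'(y) / η(y)` decreases. Indeed, as a function of
`x` it equals `(π / sin (π a)) x F(1 - x) (F(x) - 2 B(x))`, and `F - t B` has positive Taylor
coefficients for `0 ≤ t ≤ 2`; taking `t = 1` and `t = 2` shows that both `x F(1 - x)` and `F - 2 B`
increase (`hypElasticity_strictMonoOn`). For `p < 1` one has `Y' < Y`, so `η(Y u) / η(Y' u)`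
decreases in `u`, and the elasticity also yields `G(1) ≤ 0`. Writing
`G(u) = η(Y' u) (p Y η(Y u) / η(Y' u) - Y')` then gives `G > G(1)` on `(0, 1)` and `G` strictly
decreasing on `[1, ∞)`; note that `G` need not be monotone on `(0, 1)`. For `p > 1` the roles of `r`
and `r ^ p` are exchanged, for `p = 1` one has `G = 0`, and `g₆(K) = g₇(1 / K)` transfers the
results to `g₆`.
-/

open Filter Topology

/-! ### Power series with bounded coefficients -/


theorem summable_mul_pow_of_abs_le_one {c : ℕ → ℝ} (hc : ∀ n, |c n| ≤ 1) {x : ℝ} (hx : |x| < 1) :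
    Summable fun n => c n * x ^ n := by
  refine Summable.of_norm_bounded (summable_geometric_of_lt_one (abs_nonneg x) hx) fun n => ?_
  rw [norm_mul, norm_pow, Real.norm_eq_abs, Real.norm_eq_abs]
  exact mul_le_of_le_one_left (by positivity) (hc n)

theorem hasDerivAt_tsum_mul_pow {c : ℕ → ℝ} (hc : ∀ n, |c n| ≤ 1) {x : ℝ} (hx : |x| < 1) :
    (Summable fun n : ℕ => (n + 1 : ℝ) * c (n + 1) * x ^ n) ∧
    HasDerivAt (fun y => ∑' n, c n * y ^ n) (∑' n : ℕ, (n + 1 : ℝ) * c (n + 1) * x ^ n) x := by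
  obtain ⟨ρ, hxρ, hρ⟩ := exists_between hx
  have hρ0 : 0 < ρ := (abs_nonneg x).trans_lt hxρ
  have hsum : Summable fun n : ℕ => (n : ℝ) * ρ ^ (n - 1) := by
    rw [← summable_nat_add_iff 1]
    have h1 := summable_pow_mul_geometric_of_norm_lt_one 1
      (show ‖ρ‖ < 1 by rwa [Real.norm_eq_abs, abs_of_pos hρ0])
    have h2 := h1.add (summable_geometric_of_lt_one hρ0.le hρ)
    refine h2.congr fun n => ?_
    simp only [Nat.add_sub_cancel]
    push_cast
    ring
  have hbound : ∀ (n : ℕ) (y : ℝ), y ∈ Ioo (-ρ) ρ →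
      ‖c n * (n * y ^ (n - 1))‖ ≤ n * ρ ^ (n - 1) := by
    intro n y hy
    rw [norm_mul, norm_mul, norm_pow, Real.norm_eq_abs, Real.norm_eq_abs, Real.norm_eq_abs,
      Nat.abs_cast]
    refine (mul_le_of_le_one_left (by positivity) (hc n)).trans ?_
    gcongr
    exact (abs_lt.2 hy).le
  have hxm : x ∈ Ioo (-ρ) ρ := abs_lt.1 hxρ
  have hd := hasDerivAt_tsum_of_isPreconnected hsum isOpen_Ioo isPreconnected_Ioo
    (g := fun n y => c n * y ^ n) (fun n y _ => (hasDerivAt_pow n y).const_mul (c n)) hbound hxm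
    (summable_mul_pow_of_abs_le_one hc hx) hxm
  have hs : Summable fun n : ℕ => c n * (n * x ^ (n - 1)) :=
    Summable.of_norm_bounded hsum fun n => hbound n x hxm
  have hshift : ∀ n : ℕ, c (n + 1) * ((n + 1 : ℕ) * x ^ (n + 1 - 1)) =
      (n + 1 : ℝ) * c (n + 1) * x ^ n := by
    intro n
    simp only [Nat.add_sub_cancel]
    push_cast
    ring
  refine ⟨((summable_nat_add_iff 1).2 hs).congr hshift, ?_⟩
  rw [hs.tsum_eq_zero_add] at hd
  simp only [hshift] at hd
  simpa using hd

theorem tsum_mul_pow_strictMonoOn {c : ℕ → ℝ} (hc : ∀ n, |c n| ≤ 1) (hpos : ∀ n, 0 < c n) :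
    StrictMonoOn (fun x => ∑' n, c n * x ^ n) (Ico 0 1) := by
  intro x hx y hy hxy
  refine Summable.tsum_lt_tsum (i := 1) (fun n => ?_) ?_
    (summable_mul_pow_of_abs_le_one hc (abs_lt.2 ⟨by linarith [hx.1], hx.2⟩))
    (summable_mul_pow_of_abs_le_one hc (abs_lt.2 ⟨by linarith [hy.1], hy.2⟩))
  · exact mul_le_mul_of_nonneg_left (pow_le_pow_left₀ hx.1 hxy.le n) (hpos n).le
  · simpa using mul_lt_mul_of_pos_left hxy (hpos 1)

theorem tsum_mul_pow_pos {c : ℕ → ℝ} (hc : ∀ n, |c n| ≤ 1) (hpos : ∀ n, 0 < c n) {x : ℝ}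
    (hx : x ∈ Ico (0 : ℝ) 1) : 0 < ∑' n, c n * x ^ n :=
  (summable_mul_pow_of_abs_le_one hc (abs_lt.2 ⟨by linarith [hx.1], hx.2⟩)).tsum_pos
    (fun n => mul_nonneg (hpos n).le (pow_nonneg hx.1 n)) 0 (by simpa using hpos 0)

/-! ### The function `₂F₁(a, 1 - a; 1; x)` -/

/-- The coefficient `(a)ₙ (1 - a)ₙ / (n !) ^ 2` of `₂F₁(a, 1 - a; 1; x)`. -/
noncomputable def zeroBalancedCoeff (a : ℝ) (n : ℕ) : ℝ :=
  ∏ j ∈ Finset.range n, (a + j) * (1 - a + j) / (j + 1) ^ 2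

theorem zeroBalancedCoeff_zero (a : ℝ) : zeroBalancedCoeff a 0 = 1 := by
  simp [zeroBalancedCoeff]

theorem zeroBalancedCoeff_succ (a : ℝ) (n : ℕ) : zeroBalancedCoeff a (n + 1) =
    zeroBalancedCoeff a n * ((a + n) * (1 - a + n) / (n + 1) ^ 2) :=
  Finset.prod_range_succ _ _

theorem zeroBalancedCoeff_pos {a : ℝ} (ha : a ∈ Ioo (0 : ℝ) 1) (n : ℕ) :
    0 < zeroBalancedCoeff a n := by
  have h1 := ha.1
  have h2 : 0 < 1 - a := sub_pos.2 ha.2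
  exact Finset.prod_pos fun j _ => by positivity

theorem zeroBalancedCoeff_le_one {a : ℝ} (ha : a ∈ Ioo (0 : ℝ) 1) (n : ℕ) :
    zeroBalancedCoeff a n ≤ 1 := by
  have h1 := ha.1
  have h2 : 0 < 1 - a := sub_pos.2 ha.2
  refine Finset.prod_le_one (fun j _ => by positivity) fun j _ => ?_
  rw [div_le_one (by positivity), sq]
  have : (0 : ℝ) ≤ j := j.cast_nonneg
  exact mul_le_mul (by linarith) (by linarith) (by positivity) (by positivity)

theorem ordinaryHypergeometric_eq_tsum_zeroBalancedCoeff (a x : ℝ) :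
    ordinaryHypergeometric a (1 - a) (1 : ℝ) x = ∑' n, zeroBalancedCoeff a n * x ^ n := by
  rw [ordinaryHypergeometric_eq_tsum]
  refine tsum_congr fun n => ?_
  rw [smul_eq_mul]
  congr 1
  induction n with
  | zero => simp [zeroBalancedCoeff]
  | succ n ih =>
    rw [zeroBalancedCoeff_succ, ← ih]
    simp only [ascPochhammer_succ_eval, ascPochhammer_eval_one, Nat.factorial_succ]
    push_cast
    have := Nat.cast_ne_zero (R := ℝ).2 n.factorial_ne_zero
    have : (1 + (n : ℝ)) ≠ 0 := by positivity
    field_simp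
    ring

/-- `F(x) = ₂F₁(a, 1 - a; 1; x)` as a power series. -/
noncomputable def hypF (a x : ℝ) : ℝ := ∑' n, zeroBalancedCoeff a n * x ^ n

/-- The power series `B(x) = a (1 - a) ₂F₁(a, 1 - a; 2; x)`, which equals `(1 - x) F'(x)`. -/
noncomputable def hypB (a x : ℝ) : ℝ :=
  ∑' n : ℕ, a * (1 - a) / (n + 1) * zeroBalancedCoeff a n * x ^ n

theorem mul_one_sub_pos {a : ℝ} (ha : a ∈ Ioo (0 : ℝ) 1) : 0 < a * (1 - a) :=
  mul_pos ha.1 (sub_pos.2 ha.2)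

theorem mul_one_sub_le (a : ℝ) : a * (1 - a) ≤ 1 / 4 := by nlinarith [sq_nonneg (2 * a - 1)]

theorem abs_zeroBalancedCoeff_le_one {a : ℝ} (ha : a ∈ Ioo (0 : ℝ) 1) (n : ℕ) :
    |zeroBalancedCoeff a n| ≤ 1 := by
  rw [abs_of_pos (zeroBalancedCoeff_pos ha n)]
  exact zeroBalancedCoeff_le_one ha n

theorem abs_mul_zeroBalancedCoeff_le_one {a : ℝ} (ha : a ∈ Ioo (0 : ℝ) 1) {t : ℝ}
    (ht : t ∈ Icc (0 : ℝ) 1) (n : ℕ) : |t * zeroBalancedCoeff a n| ≤ 1 := by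
  rw [abs_mul, abs_of_nonneg ht.1]
  exact mul_le_one₀ ht.2 (abs_nonneg _) (abs_zeroBalancedCoeff_le_one ha n)

theorem div_succ_mem {a : ℝ} (ha : a ∈ Ioo (0 : ℝ) 1) (n : ℕ) :
    a * (1 - a) / (n + 1) ∈ Ioc (0 : ℝ) (1 / 4) := by
  have h := mul_one_sub_pos ha
  refine ⟨by positivity, (div_le_self h.le ?_).trans (mul_one_sub_le a)⟩
  linarith [n.cast_nonneg (α := ℝ)]

theorem abs_hypB_coeff_le_one {a : ℝ} (ha : a ∈ Ioo (0 : ℝ) 1) (n : ℕ) :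
    |a * (1 - a) / (n + 1) * zeroBalancedCoeff a n| ≤ 1 := by
  have h := div_succ_mem ha n
  exact abs_mul_zeroBalancedCoeff_le_one ha ⟨h.1.le, h.2.trans (by norm_num)⟩ n

/-- `F` minus `t` times `B` is a power series with coefficients in `(0, 1]` for `0 ≤ t ≤ 2`;
this provides the positivity and monotonicity facts below. -/
theorem hypF_sub_mul_hypB {a t : ℝ} (ha : a ∈ Ioo (0 : ℝ) 1) (ht : t ∈ Icc (0 : ℝ) 2) :
    StrictMonoOn (fun x => hypF a x - t * hypB a x) (Ico 0 1) ∧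
      ∀ x ∈ Ico (0 : ℝ) 1, 0 < hypF a x - t * hypB a x := by
  set c : ℕ → ℝ := fun n => (1 - t * (a * (1 - a) / (n + 1))) * zeroBalancedCoeff a n with hcdef
  have hmem : ∀ n : ℕ, 0 < 1 - t * (a * (1 - a) / (n + 1)) ∧
      1 - t * (a * (1 - a) / (n + 1)) ≤ 1 := fun n => by
    have h := div_succ_mem ha n
    constructor <;> nlinarith [h.1, h.2, ht.1, ht.2]
  have hc : ∀ n, |c n| ≤ 1 := fun n =>
    abs_mul_zeroBalancedCoeff_le_one ha ⟨(hmem n).1.le, (hmem n).2⟩ n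
  have hpos : ∀ n, 0 < c n := fun n => mul_pos (hmem n).1 (zeroBalancedCoeff_pos ha n)
  have heq : ∀ x ∈ Ico (0 : ℝ) 1, hypF a x - t * hypB a x = ∑' n, c n * x ^ n := by
    intro x hx
    have hx' : |x| < 1 := abs_lt.2 ⟨by linarith [hx.1], hx.2⟩
    rw [hypF, hypB, ← tsum_mul_left, ← Summable.tsum_sub
      (summable_mul_pow_of_abs_le_one (abs_zeroBalancedCoeff_le_one ha) hx')
      ((summable_mul_pow_of_abs_le_one (abs_hypB_coeff_le_one ha) hx').mul_left t)]
    refine tsum_congr fun n => ?_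
    simp only [hcdef]
    ring
  refine ⟨(tsum_mul_pow_strictMonoOn hc hpos).congr fun x hx => (heq x hx).symm, fun x hx => ?_⟩
  rw [heq x hx]
  exact tsum_mul_pow_pos hc hpos hx

theorem hypF_pos {a x : ℝ} (ha : a ∈ Ioo (0 : ℝ) 1) (hx : x ∈ Ico (0 : ℝ) 1) : 0 < hypF a x := by
  simpa using (hypF_sub_mul_hypB ha (t := 0) (by norm_num)).2 x hx

theorem hypF_zero (a : ℝ) : hypF a 0 = 1 := by
  rw [hypF, tsum_eq_single 0 fun n hn => by simp [hn]]
  simp [zeroBalancedCoeff_zero]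

/-- `F' = B / (1 - x)`. -/
theorem hasDerivAt_hypF {a x : ℝ} (ha : a ∈ Ioo (0 : ℝ) 1) (hx : |x| < 1) :
    HasDerivAt (hypF a) (hypB a x / (1 - x)) x := by
  obtain ⟨hs, hd⟩ := hasDerivAt_tsum_mul_pow (abs_zeroBalancedCoeff_le_one ha) hx
  have hx1 : (1 : ℝ) - x ≠ 0 := by linarith [(abs_lt.1 hx).2]
  convert! hd using 1
  rw [div_eq_iff hx1]
  -- `x F'(x) = ∑ n cₙ xⁿ`, the `n = 0` term being zero
  have hxs : Summable fun n : ℕ => (n : ℝ) * zeroBalancedCoeff a n * x ^ n := by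
    rw [← summable_nat_add_iff 1]
    refine (hs.mul_left x).congr fun n => ?_
    push_cast
    ring
  have hshift : x * ∑' n : ℕ, (n + 1 : ℝ) * zeroBalancedCoeff a (n + 1) * x ^ n =
      ∑' n : ℕ, (n : ℝ) * zeroBalancedCoeff a n * x ^ n := by
    rw [hxs.tsum_eq_zero_add, ← tsum_mul_left]
    simp only [Nat.cast_zero, zero_mul, zero_add]
    refine tsum_congr fun n => ?_
    push_cast
    ring
  rw [mul_sub, mul_one, mul_comm _ x, hshift, ← Summable.tsum_sub hs hxs, hypB]
  refine tsum_congr fun n => ?_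
  rw [zeroBalancedCoeff_succ]
  have : (n : ℝ) + 1 ≠ 0 := by positivity
  field_simp
  ring

/-- The hypergeometric differential equation in the form `(x B)' = a (1 - a) F`. -/
theorem hasDerivAt_mul_hypB {a x : ℝ} (ha : a ∈ Ioo (0 : ℝ) 1) (hx : |x| < 1) :
    HasDerivAt (fun y => y * hypB a y) (a * (1 - a) * hypF a x) x := by
  set e : ℕ → ℝ := fun n => if n = 0 then 0 else a * (1 - a) / n * zeroBalancedCoeff a (n - 1)
    with he
  have he1 : ∀ n, e (n + 1) = a * (1 - a) / (n + 1) * zeroBalancedCoeff a n := by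
    intro n
    simp [he]
  have hec : ∀ n, |e n| ≤ 1 := by
    rintro (_ | n)
    · simp [he]
    · rw [he1]
      exact abs_hypB_coeff_le_one ha n
  obtain ⟨-, hd⟩ := hasDerivAt_tsum_mul_pow hec hx
  have hval : ∑' n : ℕ, (n + 1 : ℝ) * e (n + 1) * x ^ n = a * (1 - a) * hypF a x := by
    rw [hypF, ← tsum_mul_left]
    refine tsum_congr fun n => ?_
    rw [he1]
    have : (n : ℝ) + 1 ≠ 0 := by positivity
    field_simp
  rw [hval] at hd
  refine hd.congr_of_eventuallyEq ?_
  filter_upwards [(isOpen_lt continuous_abs continuous_const).mem_nhds hx] with y hy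
  rw [(summable_mul_pow_of_abs_le_one hec hy).tsum_eq_zero_add, hypB, ← tsum_mul_left]
  simp only [he1]
  simp only [he, if_true, zero_mul, zero_add]
  exact tsum_congr fun n => by ring

theorem hasDerivAt_hypB {a x : ℝ} (ha : a ∈ Ioo (0 : ℝ) 1) (hx : |x| < 1) :
    ∃ b, HasDerivAt (hypB a) b x :=
  ⟨_, (hasDerivAt_tsum_mul_pow (abs_hypB_coeff_le_one ha) hx).2⟩

/-! ### The Legendre relation -/

/-- `n cₙ → sin (π a) / π`, from Euler's limit formula and the reflection formula for `Γ`. -/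
theorem tendsto_mul_zeroBalancedCoeff {a : ℝ} (ha : a ∈ Ioo (0 : ℝ) 1) :
    Tendsto (fun n : ℕ => (n : ℝ) * zeroBalancedCoeff a n) atTop
      (𝓝 (Real.sin (Real.pi * a) / Real.pi)) := by
  have hlim := (Real.GammaSeq_tendsto_Gamma a).mul (Real.GammaSeq_tendsto_Gamma (1 - a))
  rw [Real.Gamma_mul_Gamma_one_sub] at hlim
  have hsin : 0 < Real.sin (Real.pi * a) := Real.sin_pos_of_pos_of_lt_pi
    (mul_pos Real.pi_pos ha.1) (by nlinarith [Real.pi_pos, ha.2])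
  have hlim' := (hlim.inv₀ (by positivity)).mul (tendsto_natCast_div_add_atTop (1 : ℝ))
  rw [inv_div, mul_one] at hlim'
  rw [← tendsto_add_atTop_iff_nat 1]
  refine hlim'.congr' ?_
  filter_upwards [eventually_gt_atTop 0] with n hn
  have hprod : zeroBalancedCoeff a (n + 1) =
      (∏ j ∈ Finset.range (n + 1), (a + j)) * (∏ j ∈ Finset.range (n + 1), (1 - a + j)) /
        ((n + 1).factorial : ℝ) ^ 2 := by
    rw [zeroBalancedCoeff, Finset.prod_div_distrib, Finset.prod_mul_distrib,
      ← Finset.prod_range_add_one_eq_factorial, Finset.prod_pow]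
    push_cast
    rfl
  have hn' : (0 : ℝ) < n := Nat.cast_pos.2 hn
  have hpow : (n : ℝ) ^ a * (n : ℝ) ^ (1 - a) = n := by
    rw [← Real.rpow_add hn']
    simp
  have hfac : (n.factorial : ℝ) ≠ 0 := Nat.cast_ne_zero.2 n.factorial_ne_zero
  rw [Real.GammaSeq, Real.GammaSeq, hprod, Nat.factorial_succ, div_mul_div_comm, inv_div,
    show (n : ℝ) ^ a * n.factorial * ((n : ℝ) ^ (1 - a) * n.factorial) =
      n * (n.factorial : ℝ) ^ 2 by linear_combination (n.factorial : ℝ) ^ 2 * hpow]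
  push_cast
  field_simp

/-- The partial sums of the series of `B` at `1` telescope to `N c_N`. -/
theorem tendsto_hypB_one {a : ℝ} (ha : a ∈ Ioo (0 : ℝ) 1) :
    Tendsto (hypB a) (𝓝[<] 1) (𝓝 (Real.sin (Real.pi * a) / Real.pi)) := by
  refine Real.tendsto_tsum_powerSeries_nhdsWithin_lt ?_
  refine (tendsto_mul_zeroBalancedCoeff ha).congr fun N => ?_
  induction N with
  | zero => simp
  | succ N ih =>
    rw [Finset.sum_range_succ, ← ih, zeroBalancedCoeff_succ]
    have : (N : ℝ) + 1 ≠ 0 := by positivity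
    push_cast
    field_simp
    ring

/-- The function `h(x) = (1 - x) F(x) ^ 2`, that is `m_a / μ_a` in the variable `x = r ^ 2`. -/
noncomputable def hypH (a x : ℝ) : ℝ := (1 - x) * hypF a x ^ 2

theorem hasDerivAt_hypH {a x : ℝ} (ha : a ∈ Ioo (0 : ℝ) 1) (hx : |x| < 1) :
    HasDerivAt (hypH a) (-(hypF a x * (hypF a x - 2 * hypB a x))) x := by
  have hx1 : (1 : ℝ) - x ≠ 0 := by linarith [(abs_lt.1 hx).2]
  convert! ((hasDerivAt_id x).const_sub 1).mul ((hasDerivAt_hypF ha hx).pow 2) using 1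
  simp
  field_simp
  ring

theorem hypH_strictAntiOn {a : ℝ} (ha : a ∈ Ioo (0 : ℝ) 1) : StrictAntiOn (hypH a) (Ico 0 1) := by
  have habs : ∀ x ∈ Ico (0 : ℝ) 1, |x| < 1 := fun x hx => abs_lt.2 ⟨by linarith [hx.1], hx.2⟩
  refine strictAntiOn_of_deriv_neg (convex_Ico 0 1)
    (fun x hx => (hasDerivAt_hypH ha (habs x hx)).continuousAt.continuousWithinAt) fun x hx => ?_
  have hx' := interior_subset hx
  rw [(hasDerivAt_hypH ha (habs x hx')).deriv]
  have h1 := hypF_pos ha hx'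
  have h2 := (hypF_sub_mul_hypB ha (t := 2) (by norm_num)).2 x hx'
  have := mul_pos h1 h2
  linarith

theorem hypH_zero (a : ℝ) : hypH a 0 = 1 := by simp [hypH, hypF_zero]

theorem hypH_pos {a x : ℝ} (ha : a ∈ Ioo (0 : ℝ) 1) (hx : x ∈ Ico (0 : ℝ) 1) : 0 < hypH a x :=
  mul_pos (sub_pos.2 hx.2) (pow_pos (hypF_pos ha hx) 2)

theorem hypH_lt_one {a x : ℝ} (ha : a ∈ Ioo (0 : ℝ) 1) (hx : x ∈ Ioo (0 : ℝ) 1) : hypH a x < 1 := by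
  rw [← hypH_zero a]
  exact hypH_strictAntiOn ha (by simp) ⟨hx.1.le, hx.2⟩ hx.1

/-- `x F(1 - x) → 0` at `0`, because `h ≤ 1` gives `F(1 - x) ≤ 1 / √x`. -/
theorem tendsto_mul_hypF_one_sub {a : ℝ} (ha : a ∈ Ioo (0 : ℝ) 1) :
    Tendsto (fun x => x * hypF a (1 - x)) (𝓝[>] 0) (𝓝 0) := by
  have hsqrt : Tendsto Real.sqrt (𝓝[>] 0) (𝓝 0) := by
    simpa using (Real.continuous_sqrt.tendsto 0).mono_left nhdsWithin_le_nhds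
  have hev : ∀ᶠ x : ℝ in 𝓝[>] 0, x ∈ Ioo (0 : ℝ) 1 := Ioo_mem_nhdsGT one_pos
  refine tendsto_of_tendsto_of_tendsto_of_le_of_le' tendsto_const_nhds hsqrt ?_ ?_
  · filter_upwards [hev] with x hx
    exact mul_nonneg hx.1.le (hypF_pos ha ⟨by linarith [hx.2], by linarith [hx.1]⟩).le
  · filter_upwards [hev] with x hx
    have h := hypH_lt_one ha (x := 1 - x) ⟨by linarith [hx.2], by linarith [hx.1]⟩
    rw [hypH] at h
    refine Real.le_sqrt_of_sq_le ?_
    nlinarith [hx.1]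

/-- The Legendre relation
`x (1 - x) (F'(1 - x) F(x) + F(1 - x) F'(x)) = sin (π a) / π`. -/
theorem legendre_relation {a x : ℝ} (ha : a ∈ Ioo (0 : ℝ) 1) (hx : x ∈ Ioo (0 : ℝ) 1) :
    (1 - x) * hypB a (1 - x) * hypF a x + x * hypB a x * hypF a (1 - x) =
      Real.sin (Real.pi * a) / Real.pi := by
  set W : ℝ → ℝ := fun x =>
    (1 - x) * hypB a (1 - x) * hypF a x + x * hypB a x * hypF a (1 - x) with hW
  have hderiv : ∀ y ∈ Ioo (0 : ℝ) 1, HasDerivAt W 0 y := by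
    intro y hy
    have hy1 : |y| < 1 := abs_lt.2 ⟨by linarith [hy.1], hy.2⟩
    have hy2 : |1 - y| < 1 := abs_lt.2 ⟨by linarith [hy.2], by linarith [hy.1]⟩
    have hsub : HasDerivAt (fun z : ℝ => 1 - z) (-1) y := by
      simpa using (hasDerivAt_id y).const_sub 1
    have h1 := (hasDerivAt_mul_hypB ha hy2).comp y hsub
    have h2 := (hasDerivAt_hypF ha hy2).comp y hsub
    convert! (h1.mul (hasDerivAt_hypF ha hy1)).add ((hasDerivAt_mul_hypB ha hy1).mul h2) using 1
    have hne : y ≠ 0 := hy.1.ne'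
    have hne' : 1 - y ≠ 0 := by linarith [hy.2]
    simp only [Function.comp_apply, sub_sub_cancel]
    field_simp
    ring
  have hconst : ∀ y ∈ Ioo (0 : ℝ) 1, W y = W x := fun y hy =>
    isOpen_Ioo.is_const_of_deriv_eq_zero isPreconnected_Ioo
      (fun z hz => (hderiv z hz).differentiableAt.differentiableWithinAt)
      (fun z hz => (hderiv z hz).deriv) hy hx
  have hsub : Tendsto (fun z : ℝ => 1 - z) (𝓝[>] 0) (𝓝[<] 1) := by
    refine tendsto_nhdsWithin_iff.2 ⟨?_, ?_⟩
    · have : Tendsto (fun z : ℝ => 1 - z) (𝓝 0) (𝓝 (1 - 0)) :=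
        (continuous_const.sub continuous_id).tendsto 0
      rw [sub_zero] at this
      exact this.mono_left nhdsWithin_le_nhds
    · filter_upwards [self_mem_nhdsWithin] with z hz
      exact sub_lt_self (1 : ℝ) (mem_Ioi.1 hz)
  have hid : Tendsto (fun z : ℝ => 1 - z) (𝓝[>] 0) (𝓝 1) := hsub.mono_right nhdsWithin_le_nhds
  have h0 : |(0 : ℝ)| < 1 := by simp
  have hF : Tendsto (hypF a) (𝓝[>] 0) (𝓝 1) := by
    rw [← hypF_zero a]
    exact (hasDerivAt_hypF ha h0).continuousAt.tendsto.mono_left nhdsWithin_le_nhds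
  have hB : Tendsto (hypB a) (𝓝[>] 0) (𝓝 (hypB a 0)) :=
    (hasDerivAt_hypB ha h0).choose_spec.continuousAt.tendsto.mono_left nhdsWithin_le_nhds
  have hlim : Tendsto W (𝓝[>] 0) (𝓝 (Real.sin (Real.pi * a) / Real.pi)) := by
    have h := ((hid.mul ((tendsto_hypB_one ha).comp hsub)).mul hF).add
      (hB.mul (tendsto_mul_hypF_one_sub ha))
    simp only [one_mul, mul_one, mul_zero, add_zero] at h
    refine h.congr fun z => ?_
    simp only [hW, Function.comp_apply]
    ring
  refine tendsto_nhds_unique (tendsto_const_nhds.congr' ?_) hlim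
  filter_upwards [Ioo_mem_nhdsGT (one_pos : (0 : ℝ) < 1)] with y hy
  exact (hconst y hy).symm

/-! ### The inverse of `μ_a` in logarithmic coordinates -/

theorem sin_pi_mul_pos {a : ℝ} (ha : a ∈ Ioo (0 : ℝ) 1) : 0 < Real.sin (Real.pi * a) :=
  Real.sin_pos_of_pos_of_lt_pi (mul_pos Real.pi_pos ha.1) (by nlinarith [Real.pi_pos, ha.2])

theorem one_sub_mem_Ioo {x : ℝ} (hx : x ∈ Ioo (0 : ℝ) 1) : 1 - x ∈ Ioo (0 : ℝ) 1 :=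
  ⟨by linarith [hx.2], by linarith [hx.1]⟩

theorem abs_lt_one_of_mem_Ioo {x : ℝ} (hx : x ∈ Ioo (0 : ℝ) 1) : |x| < 1 :=
  abs_lt.2 ⟨by linarith [hx.1], hx.2⟩

/-- The function `μ_a` in the variable `x = r ^ 2`. -/
noncomputable def hypMu (a x : ℝ) : ℝ :=
  Real.pi / (2 * Real.sin (Real.pi * a)) * (hypF a (1 - x) / hypF a x)

theorem genEllipticK_eq (a r : ℝ) : genEllipticK a r = Real.pi / 2 * hypF a (r ^ 2) := by
  rw [genEllipticK, ordinaryHypergeometric_eq_tsum_zeroBalancedCoeff, hypF]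

theorem compModulus_sq {r : ℝ} (hr : r ∈ Ioo (0 : ℝ) 1) : compModulus r ^ 2 = 1 - r ^ 2 :=
  Real.sq_sqrt (by nlinarith [hr.1, hr.2])

theorem genMu_eq_hypMu {a r : ℝ} (hr : r ∈ Ioo (0 : ℝ) 1) : genMu a r = hypMu a (r ^ 2) := by
  rw [genMu, genEllipticK_eq, genEllipticK_eq, compModulus_sq hr, hypMu,
    mul_div_mul_left _ _ (by positivity)]

theorem sq_mem_Ioo {r : ℝ} (hr : r ∈ Ioo (0 : ℝ) 1) : r ^ 2 ∈ Ioo (0 : ℝ) 1 :=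
  ⟨pow_pos hr.1 2, by nlinarith [hr.1, hr.2]⟩

theorem genM_eq {a r : ℝ} (ha : a ∈ Ioo (0 : ℝ) 1) (hr : r ∈ Ioo (0 : ℝ) 1) :
    genM a r = genMu a r * hypH a (r ^ 2) := by
  have hF := hypF_pos ha (Ioo_subset_Ico_self (sq_mem_Ioo hr))
  have hsin := sin_pi_mul_pos ha
  rw [genMu_eq_hypMu hr, genM, genEllipticK_eq, genEllipticK_eq, compModulus_sq hr, hypMu, hypH]
  field_simp

theorem hypMu_pos {a x : ℝ} (ha : a ∈ Ioo (0 : ℝ) 1) (hx : x ∈ Ioo (0 : ℝ) 1) :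
    0 < hypMu a x := by
  have h1 := hypF_pos ha (Ioo_subset_Ico_self hx)
  have h2 := hypF_pos ha (Ioo_subset_Ico_self (one_sub_mem_Ioo hx))
  have h3 := sin_pi_mul_pos ha
  have h4 := Real.pi_pos
  rw [hypMu]
  positivity

/-- The derivative of `μ_a`; this is the Legendre relation. -/
theorem hasDerivAt_hypMu {a x : ℝ} (ha : a ∈ Ioo (0 : ℝ) 1) (hx : x ∈ Ioo (0 : ℝ) 1) :
    HasDerivAt (hypMu a) (-(2 * x * hypH a x)⁻¹) x := by
  have hF := hypF_pos ha (Ioo_subset_Ico_self hx)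
  have hx' := one_sub_mem_Ioo hx
  have hsin := sin_pi_mul_pos ha
  have hsub : HasDerivAt (fun z : ℝ => 1 - z) (-1) x := by
    simpa using (hasDerivAt_id x).const_sub 1
  have h := (((hasDerivAt_hypF ha (abs_lt_one_of_mem_Ioo hx')).comp x hsub).div
    (hasDerivAt_hypF ha (abs_lt_one_of_mem_Ioo hx)) hF.ne').const_mul
      (Real.pi / (2 * Real.sin (Real.pi * a)))
  have hL := legendre_relation ha hx
  have hpi := Real.pi_pos
  have hx0 : x ≠ 0 := hx.1.ne'
  have hx1 : 1 - x ≠ 0 := hx'.1.ne'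
  refine h.congr_deriv ?_
  simp only [Function.comp_apply, sub_sub_cancel, hypH]
  rw [eq_div_iff hpi.ne'] at hL
  field_simp
  linear_combination (-1) * hL

theorem exists_le_hypMu {a : ℝ} (ha : a ∈ Ioo (0 : ℝ) 1) (y : ℝ) :
    ∃ x ∈ Ioo (0 : ℝ) 1, y ≤ hypMu a x := by
  -- `μ_a + (1 / 2) log x` is decreasing because `h < 1`, so `μ_a` grows at least logarithmically
  have hd : ∀ x ∈ Ioo (0 : ℝ) 1, HasDerivAt (fun x => hypMu a x + 1 / 2 * Real.log x)
      (-(2 * x * hypH a x)⁻¹ + 1 / 2 * x⁻¹) x := fun x hx =>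
    (hasDerivAt_hypMu ha hx).add ((Real.hasDerivAt_log hx.1.ne').const_mul _)
  have hanti : AntitoneOn (fun x => hypMu a x + 1 / 2 * Real.log x) (Ioo 0 1) := by
    refine antitoneOn_of_deriv_nonpos (convex_Ioo 0 1)
      (fun x hx => (hd x hx).continuousAt.continuousWithinAt)
      (fun x hx => (hd x (interior_subset hx)).differentiableAt.differentiableWithinAt)
      fun x hx => ?_
    have hx' := interior_subset hx
    have h1 := hypH_pos ha (Ioo_subset_Ico_self hx')
    have h2 := hypH_lt_one ha hx'
    have hx0 := hx'.1
    rw [(hd x hx').deriv]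
    have : (2 * x)⁻¹ ≤ (2 * x * hypH a x)⁻¹ :=
      inv_anti₀ (by positivity) (mul_le_of_le_one_right (by positivity) h2.le)
    have h3 : (2 * x)⁻¹ = 1 / 2 * x⁻¹ := by rw [mul_inv, one_div]
    linarith
  set C := hypMu a (1 / 2) + 1 / 2 * Real.log (1 / 2)
  set x := min (1 / 2) (Real.exp (2 * (C - y))) with hx
  have hx0 : 0 < x := lt_min (by norm_num) (Real.exp_pos _)
  have hx2 : x ≤ 1 / 2 := min_le_left _ _
  have hmem : x ∈ Ioo (0 : ℝ) 1 := ⟨hx0, by linarith⟩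
  refine ⟨x, hmem, ?_⟩
  have h1 := hanti hmem (by norm_num : (1 / 2 : ℝ) ∈ Ioo (0 : ℝ) 1) hx2
  have h2 : Real.log x ≤ 2 * (C - y) := by
    rw [← Real.log_exp (2 * (C - y))]
    exact Real.log_le_log hx0 (min_le_right _ _)
  change C ≤ hypMu a x + 1 / 2 * Real.log x at h1
  linarith

theorem exists_hypMu_le {a : ℝ} (ha : a ∈ Ioo (0 : ℝ) 1) {y : ℝ} (hy : 0 < y) :
    ∃ x ∈ Ioo (0 : ℝ) 1, hypMu a x ≤ y := by
  -- `μ_a(x) μ_a(1 - x)` is constant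
  set C := Real.pi / (2 * Real.sin (Real.pi * a)) with hC
  obtain ⟨x, hx, hxy⟩ := exists_le_hypMu ha (C ^ 2 / y)
  have hx' := one_sub_mem_Ioo hx
  refine ⟨1 - x, hx', ?_⟩
  have h1 := hypF_pos ha (Ioo_subset_Ico_self hx)
  have h2 := hypF_pos ha (Ioo_subset_Ico_self hx')
  have h3 := hypMu_pos ha hx'
  have hprod : hypMu a x * hypMu a (1 - x) = C ^ 2 := by
    rw [hypMu, hypMu, sub_sub_cancel, ← hC]
    field_simp
  rw [div_le_iff₀ hy, ← hprod] at hxy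
  exact le_of_mul_le_mul_left hxy (hypMu_pos ha hx)

theorem hypMu_surjOn {a : ℝ} (ha : a ∈ Ioo (0 : ℝ) 1) : SurjOn (hypMu a) (Ioo 0 1) (Ioi 0) := by
  intro y hy
  obtain ⟨x₁, hx₁, h₁⟩ := exists_hypMu_le ha hy
  obtain ⟨x₂, hx₂, h₂⟩ := exists_le_hypMu ha y
  exact isPreconnected_Ioo.intermediate_value hx₁ hx₂
    (fun x hx => (hasDerivAt_hypMu ha hx).continuousAt.continuousWithinAt) ⟨h₁, h₂⟩

theorem hypMu_strictAntiOn {a : ℝ} (ha : a ∈ Ioo (0 : ℝ) 1) :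
    StrictAntiOn (hypMu a) (Ioo 0 1) := by
  refine strictAntiOn_of_deriv_neg (convex_Ioo 0 1)
    (fun x hx => (hasDerivAt_hypMu ha hx).continuousAt.continuousWithinAt) fun x hx => ?_
  have hx' := interior_subset hx
  have h1 := hypH_pos ha (Ioo_subset_Ico_self hx')
  have hx0 := hx'.1
  rw [(hasDerivAt_hypMu ha hx').deriv, neg_lt_zero]
  positivity

theorem genMu_surjOn {a : ℝ} (ha : a ∈ Ioo (0 : ℝ) 1) : SurjOn (genMu a) (Ioo 0 1) (Ioi 0) := by
  intro y hy
  obtain ⟨x, hx, hxy⟩ := hypMu_surjOn ha hy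
  have hs : √x ∈ Ioo (0 : ℝ) 1 :=
    ⟨Real.sqrt_pos.2 hx.1, (Real.sqrt_lt' one_pos).2 (by simpa using hx.2)⟩
  exact ⟨√x, hs, by rw [genMu_eq_hypMu hs, Real.sq_sqrt hx.1.le, hxy]⟩

theorem genMu_strictAntiOn {a : ℝ} (ha : a ∈ Ioo (0 : ℝ) 1) :
    StrictAntiOn (genMu a) (Ioo 0 1) := by
  intro r hr s hs hrs
  rw [genMu_eq_hypMu hr, genMu_eq_hypMu hs]
  exact hypMu_strictAntiOn ha (sq_mem_Ioo hr) (sq_mem_Ioo hs)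
    (pow_lt_pow_left₀ hrs hr.1.le two_ne_zero)

theorem genMu_pos {a r : ℝ} (ha : a ∈ Ioo (0 : ℝ) 1) (hr : r ∈ Ioo (0 : ℝ) 1) : 0 < genMu a r := by
  rw [genMu_eq_hypMu hr]
  exact hypMu_pos ha (sq_mem_Ioo hr)

/-- The function `σ(y) = log (1 / μ_a⁻¹(y))`, an increasing bijection of `(0, ∞)`. -/
noncomputable def logGenMuInv (a y : ℝ) : ℝ :=
  -Real.log (Function.invFunOn (genMu a) (Ioo (0 : ℝ) 1) y)

theorem invFunOn_genMu_mem {a y : ℝ} (ha : a ∈ Ioo (0 : ℝ) 1) (hy : 0 < y) :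
    Function.invFunOn (genMu a) (Ioo (0 : ℝ) 1) y ∈ Ioo (0 : ℝ) 1 :=
  Function.invFunOn_mem (genMu_surjOn ha hy)

theorem genMu_invFunOn {a y : ℝ} (ha : a ∈ Ioo (0 : ℝ) 1) (hy : 0 < y) :
    genMu a (Function.invFunOn (genMu a) (Ioo (0 : ℝ) 1) y) = y :=
  Function.invFunOn_eq (genMu_surjOn ha hy)

theorem exp_neg_logGenMuInv {a y : ℝ} (ha : a ∈ Ioo (0 : ℝ) 1) (hy : 0 < y) :
    Real.exp (-logGenMuInv a y) = Function.invFunOn (genMu a) (Ioo (0 : ℝ) 1) y := by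
  rw [logGenMuInv, neg_neg, Real.exp_log (invFunOn_genMu_mem ha hy).1]

theorem logGenMuInv_pos {a y : ℝ} (ha : a ∈ Ioo (0 : ℝ) 1) (hy : 0 < y) : 0 < logGenMuInv a y :=
  neg_pos.2 (Real.log_neg (invFunOn_genMu_mem ha hy).1 (invFunOn_genMu_mem ha hy).2)

theorem genMu_exp_neg_logGenMuInv {a y : ℝ} (ha : a ∈ Ioo (0 : ℝ) 1) (hy : 0 < y) :
    genMu a (Real.exp (-logGenMuInv a y)) = y := by
  rw [exp_neg_logGenMuInv ha hy, genMu_invFunOn ha hy]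

theorem logGenMuInv_genMu {a r : ℝ} (ha : a ∈ Ioo (0 : ℝ) 1) (hr : r ∈ Ioo (0 : ℝ) 1) :
    logGenMuInv a (genMu a r) = -Real.log r := by
  rw [logGenMuInv, (genMu_strictAntiOn ha).injOn.leftInvOn_invFunOn hr]

theorem exp_neg_mem_Ioo {t : ℝ} (ht : 0 < t) : Real.exp (-t) ∈ Ioo (0 : ℝ) 1 :=
  ⟨Real.exp_pos _, by simpa using ht⟩

theorem logGenMuInv_strictMonoOn {a : ℝ} (ha : a ∈ Ioo (0 : ℝ) 1) :
    StrictMonoOn (logGenMuInv a) (Ioi 0) := by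
  intro y hy z hz hyz
  by_contra! h
  have h' := (genMu_strictAntiOn ha).antitoneOn (exp_neg_mem_Ioo (logGenMuInv_pos ha hy))
    (exp_neg_mem_Ioo (logGenMuInv_pos ha hz)) (Real.exp_le_exp.2 (neg_le_neg h))
  rw [genMu_exp_neg_logGenMuInv ha hy, genMu_exp_neg_logGenMuInv ha hz] at h'
  exact absurd hyz h'.not_gt

theorem logGenMuInv_image {a : ℝ} (ha : a ∈ Ioo (0 : ℝ) 1) :
    logGenMuInv a '' Ioi 0 = Ioi 0 := by
  refine Subset.antisymm (image_subset_iff.2 fun y hy => logGenMuInv_pos ha hy) fun t ht => ?_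
  have hr := exp_neg_mem_Ioo ht
  exact ⟨_, genMu_pos ha hr, by rw [logGenMuInv_genMu ha hr, Real.log_exp, neg_neg]⟩

theorem continuousAt_logGenMuInv {a y : ℝ} (ha : a ∈ Ioo (0 : ℝ) 1) (hy : 0 < y) :
    ContinuousAt (logGenMuInv a) y := by
  refine (logGenMuInv_strictMonoOn ha).continuousAt_of_image_mem_nhds (Ioi_mem_nhds hy) ?_
  rw [logGenMuInv_image ha]
  exact Ioi_mem_nhds (logGenMuInv_pos ha hy)

/-- The square `x = e ^ (-2 σ(y))` of the point at which `μ_a` takes the value `y`. -/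
noncomputable def sqGenMuInv (a y : ℝ) : ℝ := Real.exp (-logGenMuInv a y) ^ 2

theorem sqGenMuInv_mem {a y : ℝ} (ha : a ∈ Ioo (0 : ℝ) 1) (hy : 0 < y) :
    sqGenMuInv a y ∈ Ioo (0 : ℝ) 1 := sq_mem_Ioo (exp_neg_mem_Ioo (logGenMuInv_pos ha hy))

theorem hypMu_sqGenMuInv {a y : ℝ} (ha : a ∈ Ioo (0 : ℝ) 1) (hy : 0 < y) :
    hypMu a (sqGenMuInv a y) = y := by
  rw [sqGenMuInv, ← genMu_eq_hypMu (exp_neg_mem_Ioo (logGenMuInv_pos ha hy)),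
    genMu_exp_neg_logGenMuInv ha hy]

theorem sqGenMuInv_strictAntiOn {a : ℝ} (ha : a ∈ Ioo (0 : ℝ) 1) :
    StrictAntiOn (sqGenMuInv a) (Ioi 0) := by
  intro y hy z hz hyz
  exact pow_lt_pow_left₀ (Real.exp_lt_exp.2 (neg_lt_neg (logGenMuInv_strictMonoOn ha hy hz hyz)))
    (Real.exp_pos _).le two_ne_zero

theorem hasDerivAt_logGenMuInv {a y : ℝ} (ha : a ∈ Ioo (0 : ℝ) 1) (hy : 0 < y) :
    HasDerivAt (logGenMuInv a) (hypH a (sqGenMuInv a y)) y := by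
  have hx := sqGenMuInv_mem ha hy
  have hh := hypH_pos ha (Ioo_subset_Ico_self hx)
  have hexp : HasDerivAt (fun t => Real.exp (-t) ^ 2) (-(2 * sqGenMuInv a y)) (logGenMuInv a y) := by
    refine ((hasDerivAt_neg (logGenMuInv a y)).exp.pow 2).congr_deriv ?_
    rw [sqGenMuInv]
    push_cast
    ring
  have hmu : HasDerivAt (fun t => hypMu a (Real.exp (-t) ^ 2)) (hypH a (sqGenMuInv a y))⁻¹
      (logGenMuInv a y) := by
    refine ((hasDerivAt_hypMu ha hx).comp (logGenMuInv a y) hexp).congr_deriv ?_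
    have hx0 := hx.1
    field_simp
  refine (HasDerivAt.of_local_left_inverse (continuousAt_logGenMuInv ha hy) hmu
    (inv_ne_zero hh.ne') ?_).congr_deriv (inv_inv _)
  filter_upwards [Ioi_mem_nhds hy] with z hz using hypMu_sqGenMuInv ha hz

theorem hasDerivAt_sqGenMuInv {a y : ℝ} (ha : a ∈ Ioo (0 : ℝ) 1) (hy : 0 < y) :
    HasDerivAt (sqGenMuInv a) (-(2 * sqGenMuInv a y * hypH a (sqGenMuInv a y))) y := by
  refine ((hasDerivAt_logGenMuInv ha hy).neg.exp.pow 2).congr_deriv ?_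
  rw [sqGenMuInv]
  simp only [Pi.neg_apply]
  push_cast
  ring

theorem tendsto_logGenMuInv_zero {a : ℝ} (ha : a ∈ Ioo (0 : ℝ) 1) :
    Tendsto (logGenMuInv a) (𝓝[>] 0) (𝓝 0) := by
  refine (nhds_basis_Ioo_pos (0 : ℝ)).tendsto_right_iff.2 fun ε hε => ?_
  have hr := exp_neg_mem_Ioo hε
  filter_upwards [Ioo_mem_nhdsGT (genMu_pos ha hr)] with y hy
  have h := logGenMuInv_strictMonoOn ha hy.1 (genMu_pos ha hr) hy.2
  rw [logGenMuInv_genMu ha hr, Real.log_exp, neg_neg] at h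
  exact ⟨by linarith [logGenMuInv_pos ha hy.1], by linarith⟩

theorem tendsto_sqGenMuInv_atTop {a : ℝ} (ha : a ∈ Ioo (0 : ℝ) 1) :
    Tendsto (sqGenMuInv a) atTop (𝓝 0) := by
  refine (nhds_basis_Ioo_pos (0 : ℝ)).tendsto_right_iff.2 fun ε hε => ?_
  set x := min ε (1 / 2)
  have hx : x ∈ Ioo (0 : ℝ) 1 :=
    ⟨lt_min hε (by norm_num), (min_le_right _ _).trans_lt (by norm_num)⟩
  filter_upwards [eventually_gt_atTop (hypMu a x)] with y hy
  have hy0 := (hypMu_pos ha hx).trans hy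
  have hm := sqGenMuInv_mem ha hy0
  refine ⟨by linarith [hm.1], ?_⟩
  rw [zero_add]
  refine lt_of_lt_of_le ?_ (min_le_left ε (1 / 2))
  by_contra! h
  have := (hypMu_strictAntiOn ha).antitoneOn hx hm h
  rw [hypMu_sqGenMuInv ha hy0] at this
  linarith

/-! ### The comparison function `G` for a function with decreasing elasticity -/

/-- Functions `σ, η, D` on `(0, ∞)` such that `σ` is positive with `σ(0+) = 0` and `σ' = η`,
where `η` increases to `1` and its logarithmic derivative `D(y) = y η'(y) / η(y)` is decreasing. -/
structure DecreasingElasticity (σ η D : ℝ → ℝ) : Prop where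
  pos : ∀ y, 0 < y → 0 < σ y
  strictMonoOn : StrictMonoOn σ (Ioi 0)
  hasDerivAt : ∀ y, 0 < y → HasDerivAt σ (η y) y
  tendsto_zero : Tendsto σ (𝓝[>] 0) (𝓝 0)
  deriv_pos : ∀ y, 0 < y → 0 < η y
  deriv_lt_one : ∀ y, 0 < y → η y < 1
  deriv_strictMonoOn : StrictMonoOn η (Ioi 0)
  hasDerivAt_deriv : ∀ y, 0 < y → HasDerivAt η (η y * D y / y) y
  tendsto_deriv : Tendsto η atTop (𝓝 1)
  elasticity_strictAntiOn : StrictAntiOn D (Ioi 0)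

/-- `u ↦ p Y η(Y u) - Y' η(Y' u)`, the derivative of `u ↦ p σ(Y u) - σ(Y' u)` when `σ' = η`. -/
def comparison (η : ℝ → ℝ) (p Y Y' u : ℝ) : ℝ := p * (Y * η (Y * u)) - Y' * η (Y' * u)

namespace DecreasingElasticity

variable {σ η D : ℝ → ℝ} {p Y Y' : ℝ}

theorem lt_of_eq_mul (h : DecreasingElasticity σ η D) (hp : p < 1) (hY : 0 < Y) (hY' : 0 < Y')
    (hσ : σ Y' = p * σ Y) : Y' < Y := by
  by_contra! hle
  have h1 := h.strictMonoOn.monotoneOn hY hY' hle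
  nlinarith [h.pos Y hY]

/-- The monotonicity of `y η / σ`, in the form needed: `G(1) ≤ 0`. -/
theorem comparison_one_nonpos (h : DecreasingElasticity σ η D) (hp0 : 0 < p) (hp : p < 1)
    (hY : 0 < Y) (hY' : 0 < Y') (hσ : σ Y' = p * σ Y) : comparison η p Y Y' 1 ≤ 0 := by
  have hlt := h.lt_of_eq_mul hp hY hY' hσ
  -- `k` increases on `(0, Y']` from `k(0+) = 0` and decreases on `[Y', ∞)`,
  -- since `k' = η (D - D(Y'))`
  set k : ℝ → ℝ := fun t => t * η t - (1 + D Y') * σ t with hk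
  have hd : ∀ t, 0 < t → HasDerivAt k (η t * (D t - D Y')) t := by
    intro t ht
    refine (((hasDerivAt_id t).mul (h.hasDerivAt_deriv t ht)).sub
      ((h.hasDerivAt t ht).const_mul (1 + D Y'))).congr_deriv ?_
    simp only [id]
    field_simp
    ring
  have hmono : MonotoneOn k (Ioc 0 Y') := by
    refine monotoneOn_of_deriv_nonneg (convex_Ioc 0 Y')
      (fun t ht => (hd t ht.1).continuousAt.continuousWithinAt)
      (fun t ht => (hd t (interior_subset ht).1).differentiableAt.differentiableWithinAt)
      fun t ht => ?_
    have ht' := interior_subset ht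
    rw [(hd t ht'.1).deriv]
    exact mul_nonneg (h.deriv_pos t ht'.1).le
      (sub_nonneg.2 (h.elasticity_strictAntiOn.antitoneOn ht'.1 hY' ht'.2))
  have hanti : AntitoneOn k (Ici Y') := by
    refine antitoneOn_of_deriv_nonpos (convex_Ici Y')
      (fun t ht => (hd t (hY'.trans_le ht)).continuousAt.continuousWithinAt)
      (fun t ht => (hd t (hY'.trans_le
        (interior_subset ht))).differentiableAt.differentiableWithinAt)
      fun t ht => ?_
    have ht' : Y' ≤ t := interior_subset ht
    have ht0 := hY'.trans_le ht'
    rw [(hd t ht0).deriv]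
    exact mul_nonpos_of_nonneg_of_nonpos (h.deriv_pos t ht0).le
      (sub_nonpos.2 (h.elasticity_strictAntiOn.antitoneOn hY' ht0 ht'))
  have hlim : Tendsto k (𝓝[>] 0) (𝓝 0) := by
    have hid : Tendsto (fun t : ℝ => t) (𝓝[>] 0) (𝓝 0) := nhdsWithin_le_nhds
    have h1 : Tendsto (fun t => t * η t) (𝓝[>] 0) (𝓝 0) := by
      refine tendsto_of_tendsto_of_tendsto_of_le_of_le' tendsto_const_nhds hid ?_ ?_
      · filter_upwards [self_mem_nhdsWithin] with t ht
        exact mul_nonneg (le_of_lt ht) (h.deriv_pos t ht).le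
      · filter_upwards [self_mem_nhdsWithin] with t ht
        exact mul_le_of_le_one_right (le_of_lt ht) (h.deriv_lt_one t ht).le
    simpa using h1.sub (h.tendsto_zero.const_mul (1 + D Y'))
  have hk0 : 0 ≤ k Y' := by
    refine le_of_tendsto hlim ?_
    filter_upwards [Ioc_mem_nhdsGT hY'] with t ht using hmono ht (right_mem_Ioc.2 hY') ht.2
  have hkY : k Y ≤ k Y' := hanti self_mem_Ici hlt.le hlt.le
  simp only [hk, hσ] at hk0 hkY
  rw [comparison, mul_one, mul_one]
  nlinarith

theorem ratio_strictAntiOn (h : DecreasingElasticity σ η D) (hY' : 0 < Y') (hlt : Y' < Y) :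
    StrictAntiOn (fun u => η (Y * u) / η (Y' * u)) (Ioi 0) := by
  have hY := hY'.trans hlt
  have hcomp : ∀ c, 0 < c → ∀ u, 0 < u →
      HasDerivAt (fun u => η (c * u)) (η (c * u) * D (c * u) / u) u := by
    intro c hc u hu
    have hcu := mul_pos hc hu
    refine ((h.hasDerivAt_deriv _ hcu).comp u ((hasDerivAt_id u).const_mul c)).congr_deriv ?_
    field_simp
  have hd : ∀ u, 0 < u → HasDerivAt (fun u => η (Y * u) / η (Y' * u))
      (η (Y * u) / η (Y' * u) / u * (D (Y * u) - D (Y' * u))) u := by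
    intro u hu
    have hη := h.deriv_pos _ (mul_pos hY' hu)
    refine ((hcomp Y hY u hu).div (hcomp Y' hY' u hu) hη.ne').congr_deriv ?_
    field_simp
  refine strictAntiOn_of_deriv_neg (convex_Ioi 0)
    (fun u hu => (hd u hu).continuousAt.continuousWithinAt) fun u hu => ?_
  have hu' : 0 < u := interior_subset hu
  rw [(hd u hu').deriv]
  have h1 := h.deriv_pos _ (mul_pos hY hu')
  have h2 := h.deriv_pos _ (mul_pos hY' hu')
  exact mul_neg_of_pos_of_neg (by positivity) (sub_neg.2 (h.elasticity_strictAntiOn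
    (mul_pos hY' hu') (mul_pos hY hu') (mul_lt_mul_of_pos_right hlt hu')))

/-- `G` is the product of the increasing positive function `η(Y' u)` and a factor that is
decreasing in `u` when `Y' < Y`. -/
theorem comparison_eq (h : DecreasingElasticity σ η D) (hY' : 0 < Y') {u : ℝ} (hu : 0 < u) :
    comparison η p Y Y' u = η (Y' * u) * (p * Y * (η (Y * u) / η (Y' * u)) - Y') := by
  have hpos := h.deriv_pos _ (mul_pos hY' hu)
  rw [comparison]
  generalize η (Y' * u) = c at hpos ⊢
  field_simp

theorem factor_lt (h : DecreasingElasticity σ η D) (hp0 : 0 < p) (hY' : 0 < Y') (hlt : Y' < Y)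
    {u v : ℝ} (hu : 0 < u) (huv : u < v) :
    p * Y * (η (Y * v) / η (Y' * v)) - Y' < p * Y * (η (Y * u) / η (Y' * u)) - Y' := by
  have hY := hY'.trans hlt
  exact sub_lt_sub_right (mul_lt_mul_of_pos_left
    (h.ratio_strictAntiOn hY' hlt hu (hu.trans huv) huv) (by positivity)) _

theorem factor_one_nonpos (h : DecreasingElasticity σ η D) (hp0 : 0 < p) (hp : p < 1)
    (hY : 0 < Y) (hY' : 0 < Y') (hσ : σ Y' = p * σ Y) :
    p * Y * (η (Y * 1) / η (Y' * 1)) - Y' ≤ 0 := by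
  have h0 := h.comparison_one_nonpos hp0 hp hY hY' hσ
  rw [h.comparison_eq hY' one_pos] at h0
  exact nonpos_of_mul_nonpos_right h0 (h.deriv_pos _ (mul_pos hY' one_pos))

theorem comparison_one_lt (h : DecreasingElasticity σ η D) (hp0 : 0 < p) (hp : p < 1)
    (hY : 0 < Y) (hY' : 0 < Y') (hσ : σ Y' = p * σ Y) {u : ℝ} (hu : u ∈ Ioo (0 : ℝ) 1) :
    comparison η p Y Y' 1 < comparison η p Y Y' u := by
  have hlt := h.lt_of_eq_mul hp hY hY' hσ
  have h1 := h.factor_one_nonpos hp0 hp hY hY' hσ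
  have h2 := h.factor_lt hp0 hY' hlt hu.1 hu.2
  have h3 := h.deriv_strictMonoOn (mul_pos hY' hu.1) (mul_pos hY' one_pos)
    (mul_lt_mul_of_pos_left hu.2 hY')
  have h4 := h.deriv_pos _ (mul_pos hY' hu.1)
  rw [h.comparison_eq hY' one_pos, h.comparison_eq hY' hu.1]
  exact (mul_le_mul_of_nonpos_right h3.le h1).trans_lt (mul_lt_mul_of_pos_left h2 h4)

theorem comparison_strictAntiOn (h : DecreasingElasticity σ η D) (hp0 : 0 < p) (hp : p < 1)
    (hY : 0 < Y) (hY' : 0 < Y') (hσ : σ Y' = p * σ Y) :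
    StrictAntiOn (comparison η p Y Y') (Ici 1) := by
  intro u hu v hv huv
  have hu0 : 0 < u := one_pos.trans_le hu
  have hlt := h.lt_of_eq_mul hp hY hY' hσ
  have h1 : p * Y * (η (Y * u) / η (Y' * u)) - Y' ≤ 0 := by
    rcases (mem_Ici.1 hu).eq_or_lt with rfl | hu1
    · exact h.factor_one_nonpos hp0 hp hY hY' hσ
    · exact (h.factor_lt hp0 hY' hlt one_pos hu1).le.trans
        (h.factor_one_nonpos hp0 hp hY hY' hσ)
  have h2 := h.factor_lt hp0 hY' hlt hu0 huv
  have h3 := h.deriv_strictMonoOn (mul_pos hY' hu0) (mul_pos hY' (hu0.trans huv))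
    (mul_lt_mul_of_pos_left huv hY')
  have h4 := h.deriv_pos _ (mul_pos hY' hu0)
  rw [h.comparison_eq hY' hu0, h.comparison_eq hY' (hu0.trans huv)]
  exact (mul_le_mul_of_nonpos_right h3.le (h2.le.trans h1)).trans_lt
    (mul_lt_mul_of_pos_left h2 h4)

theorem tendsto_comparison (h : DecreasingElasticity σ η D) (hY : 0 < Y) (hY' : 0 < Y') :
    Tendsto (comparison η p Y Y') atTop (𝓝 (p * Y - Y')) := by
  have hc : ∀ c, 0 < c → Tendsto (fun u => c * η (c * u)) atTop (𝓝 c) := fun c hc => by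
    simpa using (h.tendsto_deriv.comp (tendsto_id.const_mul_atTop hc)).const_mul c
  exact ((hc Y hY).const_mul p).sub (hc Y' hY')

theorem lt_comparison (h : DecreasingElasticity σ η D) (hp0 : 0 < p) (hp : p < 1)
    (hY : 0 < Y) (hY' : 0 < Y') (hσ : σ Y' = p * σ Y) {u : ℝ} (hu : 1 ≤ u) :
    p * Y - Y' < comparison η p Y Y' u := by
  have hanti := h.comparison_strictAntiOn hp0 hp hY hY' hσ
  refine (le_of_tendsto (h.tendsto_comparison hY hY') ?_).trans_lt
    (hanti hu (hu.trans (by linarith)) (lt_add_one u))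
  filter_upwards [eventually_ge_atTop (u + 1)] with v hv
  have : 1 ≤ u + 1 := by linarith
  exact hanti.antitoneOn this (this.trans hv) hv

theorem continuousAt_comparison_one (h : DecreasingElasticity σ η D) (hY : 0 < Y) (hY' : 0 < Y') :
    ContinuousAt (comparison η p Y Y') 1 := by
  have hc : ∀ c, 0 < c → ContinuousAt (fun u => c * η (c * u)) 1 := fun c hc => by
    have := (h.hasDerivAt_deriv (c * 1) (mul_pos hc one_pos)).continuousAt
    exact continuousAt_const.mul (this.comp (f := fun u => c * u)
      (continuousAt_const.mul continuousAt_id))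
  exact (continuousAt_const.mul (hc Y hY)).sub (hc Y' hY')

end DecreasingElasticity

/-! ### Monotonicity criteria for a function with derivative `ρ - G` -/

section Criteria

variable {f G : ℝ → ℝ} {ρ : ℝ}

theorem strictAntiOn_Ioc_iff_le (hf : ∀ u, 0 < u → HasDerivAt f (ρ - G u) u)
    (hG : ContinuousAt G 1) (hlt : ∀ u ∈ Ioo (0 : ℝ) 1, G 1 < G u) :
    StrictAntiOn f (Ioc 0 1) ↔ ρ ≤ G 1 := by
  constructor
  · intro hanti
    refine ge_of_tendsto (hG.tendsto.mono_left (nhdsWithin_le_nhds (s := Iio 1))) ?_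
    filter_upwards [Ioo_mem_nhdsLT (one_pos : (0 : ℝ) < 1)] with u hu
    have h := hanti.antitoneOn.derivWithin_nonpos (x := u)
    rw [derivWithin_of_mem_nhds (Ioc_mem_nhds hu.1 hu.2), (hf u hu.1).deriv] at h
    linarith
  · intro hρ
    refine strictAntiOn_of_deriv_neg (convex_Ioc 0 1)
      (fun u hu => (hf u hu.1).continuousAt.continuousWithinAt) fun u hu => ?_
    rw [interior_Ioc] at hu
    rw [(hf u hu.1).deriv]
    linarith [hlt u hu]

theorem strictMonoOn_Ici_iff_le (hf : ∀ u, 0 < u → HasDerivAt f (ρ - G u) u)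
    (hG : ContinuousAt G 1) (hlt : ∀ u, 1 < u → G u < G 1) :
    StrictMonoOn f (Ici 1) ↔ G 1 ≤ ρ := by
  constructor
  · intro hmono
    refine le_of_tendsto (hG.tendsto.mono_left (nhdsWithin_le_nhds (s := Ioi 1))) ?_
    filter_upwards [self_mem_nhdsWithin] with u hu
    have h := hmono.monotoneOn.derivWithin_nonneg (x := u)
    rw [derivWithin_of_mem_nhds (Ici_mem_nhds hu), (hf u (one_pos.trans hu)).deriv] at h
    linarith
  · intro hρ
    refine strictMonoOn_of_deriv_pos (convex_Ici 1)
      (fun u hu => (hf u (one_pos.trans_le hu)).continuousAt.continuousWithinAt) fun u hu => ?_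
    rw [interior_Ici] at hu
    rw [(hf u (one_pos.trans hu)).deriv]
    linarith [hlt u hu]

theorem strictAntiOn_Ici_iff_le {l : ℝ} (hf : ∀ u, 0 < u → HasDerivAt f (ρ - G u) u)
    (hG : Tendsto G atTop (𝓝 l)) (hlt : ∀ u, 1 ≤ u → l < G u) :
    StrictAntiOn f (Ici 1) ↔ ρ ≤ l := by
  constructor
  · intro hanti
    refine ge_of_tendsto hG ?_
    filter_upwards [eventually_gt_atTop 1] with u hu
    have h := hanti.antitoneOn.derivWithin_nonpos (x := u)
    rw [derivWithin_of_mem_nhds (Ici_mem_nhds hu), (hf u (one_pos.trans hu)).deriv] at h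
    linarith
  · intro hρ
    refine strictAntiOn_of_deriv_neg (convex_Ici 1)
      (fun u hu => (hf u (one_pos.trans_le hu)).continuousAt.continuousWithinAt) fun u hu => ?_
    rw [interior_Ici] at hu
    rw [(hf u (one_pos.trans hu)).deriv]
    linarith [hlt u (le_of_lt hu)]

end Criteria

/-! ### The distortion function -/

/-- The elasticity `y η'(y) / η(y)` of `η(y) = h(x(y))`, where `x(y) = μ_a⁻¹(y) ^ 2`, as a function
of `x`: `D = (π / sin (π a)) x F(1 - x) (F(x) - 2 B(x))`. -/
noncomputable def hypElasticity (a x : ℝ) : ℝ :=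
  Real.pi / Real.sin (Real.pi * a) * (x * hypF a (1 - x) * (hypF a x - 2 * hypB a x))

/-- Both factors `x F(1 - x)`, with derivative `(F - B)(1 - x)`, and `F - 2 B` increase. -/
theorem hypElasticity_strictMonoOn {a : ℝ} (ha : a ∈ Ioo (0 : ℝ) 1) :
    StrictMonoOn (hypElasticity a) (Ioo 0 1) := by
  have hd : ∀ x ∈ Ioo (0 : ℝ) 1, HasDerivAt (fun x => x * hypF a (1 - x))
      (hypF a (1 - x) - 1 * hypB a (1 - x)) x := by
    intro x hx
    have hsub : HasDerivAt (fun z : ℝ => 1 - z) (-1) x := by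
      simpa using (hasDerivAt_id x).const_sub 1
    refine ((hasDerivAt_id x).mul ((hasDerivAt_hypF ha
      (abs_lt_one_of_mem_Ioo (one_sub_mem_Ioo hx))).comp x hsub)).congr_deriv ?_
    have hx0 : x ≠ 0 := hx.1.ne'
    simp only [id, Function.comp_apply, sub_sub_cancel]
    field_simp
    ring
  have hmono : StrictMonoOn (fun x => x * hypF a (1 - x)) (Ioo 0 1) := by
    refine strictMonoOn_of_deriv_pos (convex_Ioo 0 1)
      (fun x hx => (hd x hx).continuousAt.continuousWithinAt) fun x hx => ?_
    have hx' := interior_subset hx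
    rw [(hd x hx').deriv]
    exact (hypF_sub_mul_hypB ha (by norm_num)).2 _ (Ioo_subset_Ico_self (one_sub_mem_Ioo hx'))
  intro x hx y hy hxy
  have hP := hypF_sub_mul_hypB ha (t := 2) (by norm_num)
  have hFy := hypF_pos ha (Ioo_subset_Ico_self (one_sub_mem_Ioo hy))
  exact mul_lt_mul_of_pos_left
    (mul_lt_mul'' (hmono hx hy hxy)
      (hP.1 (Ioo_subset_Ico_self hx) (Ioo_subset_Ico_self hy) hxy)
      (mul_nonneg hx.1.le (hypF_pos ha (Ioo_subset_Ico_self (one_sub_mem_Ioo hx))).le)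
      (hP.2 x (Ioo_subset_Ico_self hx)).le)
    (div_pos Real.pi_pos (sin_pi_mul_pos ha))

theorem decreasingElasticity_logGenMuInv {a : ℝ} (ha : a ∈ Ioo (0 : ℝ) 1) :
    DecreasingElasticity (logGenMuInv a) (fun y => hypH a (sqGenMuInv a y))
      (fun y => hypElasticity a (sqGenMuInv a y)) where
  pos _ hy := logGenMuInv_pos ha hy
  strictMonoOn := logGenMuInv_strictMonoOn ha
  hasDerivAt _ hy := hasDerivAt_logGenMuInv ha hy
  tendsto_zero := tendsto_logGenMuInv_zero ha
  deriv_pos _ hy := hypH_pos ha (Ioo_subset_Ico_self (sqGenMuInv_mem ha hy))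
  deriv_lt_one _ hy := hypH_lt_one ha (sqGenMuInv_mem ha hy)
  deriv_strictMonoOn _ hy _ hz hyz :=
    hypH_strictAntiOn ha (Ioo_subset_Ico_self (sqGenMuInv_mem ha hz))
      (Ioo_subset_Ico_self (sqGenMuInv_mem ha hy)) (sqGenMuInv_strictAntiOn ha hy hz hyz)
  hasDerivAt_deriv y hy := by
    have hx := sqGenMuInv_mem ha hy
    refine ((hasDerivAt_hypH ha (abs_lt_one_of_mem_Ioo hx)).comp y
      (hasDerivAt_sqGenMuInv ha hy)).congr_deriv ?_
    -- `D = -2 x h'(x) μ_a`, with `μ_a = y`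
    have hy' : y = Real.pi / (2 * Real.sin (Real.pi * a)) *
        (hypF a (1 - sqGenMuInv a y) / hypF a (sqGenMuInv a y)) := (hypMu_sqGenMuInv ha hy).symm
    have hsin := sin_pi_mul_pos ha
    have hF := hypF_pos ha (Ioo_subset_Ico_self hx)
    rw [eq_div_iff hy.ne', hypElasticity]
    generalize sqGenMuInv a y = x at hy' hF ⊢
    rw [hy']
    field_simp
  tendsto_deriv := by
    rw [← hypH_zero a]
    exact (hasDerivAt_hypH ha (x := 0) (by simp)).continuousAt.tendsto.comp
      (tendsto_sqGenMuInv_atTop ha)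
  elasticity_strictAntiOn _ hy _ hz hyz :=
    hypElasticity_strictMonoOn ha (sqGenMuInv_mem ha hz) (sqGenMuInv_mem ha hy)
      (sqGenMuInv_strictAntiOn ha hy hz hyz)

theorem hypH_sqGenMuInv_genMu {a r : ℝ} (ha : a ∈ Ioo (0 : ℝ) 1) (hr : r ∈ Ioo (0 : ℝ) 1) :
    genMu a r * hypH a (sqGenMuInv a (genMu a r)) = genM a r := by
  rw [sqGenMuInv, logGenMuInv_genMu ha hr, neg_neg, Real.exp_log hr.1, genM_eq ha hr]

theorem comparison_one_eq {a r p : ℝ} (ha : a ∈ Ioo (0 : ℝ) 1) (hr : r ∈ Ioo (0 : ℝ) 1)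
    (hrp : r ^ p ∈ Ioo (0 : ℝ) 1) :
    comparison (fun y => hypH a (sqGenMuInv a y)) p (genMu a r) (genMu a (r ^ p)) 1 =
      p * genM a r - genM a (r ^ p) := by
  simp only [comparison, mul_one]
  rw [hypH_sqGenMuInv_genMu ha hr, hypH_sqGenMuInv_genMu ha hrp]

theorem logGenMuInv_genMu_rpow {a r p : ℝ} (ha : a ∈ Ioo (0 : ℝ) 1) (hr : r ∈ Ioo (0 : ℝ) 1)
    (hrp : r ^ p ∈ Ioo (0 : ℝ) 1) :
    logGenMuInv a (genMu a (r ^ p)) = p * logGenMuInv a (genMu a r) := by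
  rw [logGenMuInv_genMu ha hr, logGenMuInv_genMu ha hrp, Real.log_rpow hr.1, mul_neg]

theorem rpow_mem_Ioo {r p : ℝ} (hr : r ∈ Ioo (0 : ℝ) 1) (hp : 0 < p) : r ^ p ∈ Ioo (0 : ℝ) 1 :=
  ⟨Real.rpow_pos_of_pos hr.1 p, Real.rpow_lt_one hr.1.le hr.2 hp⟩

/-- The logarithm of `g₇`, in terms of `σ = -log μ_a⁻¹`. -/
noncomputable def logGSeven (a r p ρ u : ℝ) : ℝ :=
  ρ * u - (p * logGenMuInv a (genMu a r * u) - logGenMuInv a (genMu a (r ^ p) * u))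

theorem gSeven_eq_exp (ρ : ℝ → ℝ → ℝ) {a r p u : ℝ} (ha : a ∈ Ioo (0 : ℝ) 1)
    (hr : r ∈ Ioo (0 : ℝ) 1) (hp : 0 < p) (hu : 0 < u) :
    gSeven ρ a r p u = Real.exp (logGSeven a r p (ρ a r) u) := by
  have h1 := mul_pos (genMu_pos ha hr) hu
  have h2 := mul_pos (genMu_pos ha (rpow_mem_Ioo hr hp)) hu
  rw [gSeven, genPhi, genPhi, div_div_eq_mul_div, div_div_eq_mul_div, div_one, div_one,
    ← exp_neg_logGenMuInv ha h1, ← exp_neg_logGenMuInv ha h2, ← Real.exp_mul, ← Real.exp_mul,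
    ← Real.exp_add, ← Real.exp_sub, logGSeven]
  congr 1
  ring

theorem gSix_eq_gSeven (ξ : ℝ → ℝ → ℝ) (a r p K : ℝ) :
    gSix ξ a r p K = gSeven ξ a r p (1 / K) := by
  rw [gSix, gSeven, one_div_one_div]

theorem hasDerivAt_logGSeven {a r p ρ u : ℝ} (ha : a ∈ Ioo (0 : ℝ) 1)
    (hr : r ∈ Ioo (0 : ℝ) 1) (hp : 0 < p) (hu : 0 < u) :
    HasDerivAt (logGSeven a r p ρ)
      (ρ - comparison (fun y => hypH a (sqGenMuInv a y)) p (genMu a r) (genMu a (r ^ p)) u) u := by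
  have hc : ∀ c, 0 < c → HasDerivAt (fun u => logGenMuInv a (c * u))
      (c * hypH a (sqGenMuInv a (c * u))) u := fun c hc => by
    refine ((hasDerivAt_logGenMuInv ha (mul_pos hc hu)).comp u
      ((hasDerivAt_id u).const_mul c)).congr_deriv ?_
    ring
  refine (((hasDerivAt_id u).const_mul ρ).sub (((hc _ (genMu_pos ha hr)).const_mul p).sub
    (hc _ (genMu_pos ha (rpow_mem_Ioo hr hp))))).congr_deriv ?_
  rw [mul_one, comparison]

/-- Exchanging `r` and `r ^ p`, hence `p` and `1 / p`, multiplies `G` by `-1 / p`. -/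
theorem neg_comparison_eq (η : ℝ → ℝ) {p : ℝ} (hp : p ≠ 0) (Y Y' u : ℝ) :
    -comparison η p Y Y' u = p * comparison η p⁻¹ Y' Y u := by
  simp only [comparison]
  field_simp
  ring

/-! ### Transfer between `g₇`, its logarithm and `g₆` -/

theorem strictMonoOn_exp_comp_iff {f g : ℝ → ℝ} {s : Set ℝ} (h : ∀ x ∈ s, g x = Real.exp (f x)) :
    StrictMonoOn g s ↔ StrictMonoOn f s := by
  refine forall₂_congr fun x hx => forall₂_congr fun y hy => ?_
  rw [h x hx, h y hy, Real.exp_lt_exp]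

theorem strictAntiOn_exp_comp_iff {f g : ℝ → ℝ} {s : Set ℝ} (h : ∀ x ∈ s, g x = Real.exp (f x)) :
    StrictAntiOn g s ↔ StrictAntiOn f s := by
  refine forall₂_congr fun x hx => forall₂_congr fun y hy => ?_
  rw [h x hx, h y hy, Real.exp_lt_exp]

theorem strictAntiOn_one_div_Ioc : StrictAntiOn (fun K : ℝ => 1 / K) (Ioc 0 1) :=
  fun _ hx _ _ hxy => one_div_lt_one_div_of_lt hx.1 hxy

theorem strictAntiOn_one_div_Ici : StrictAntiOn (fun K : ℝ => 1 / K) (Ici 1) :=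
  fun _ hx _ _ hxy => one_div_lt_one_div_of_lt (one_pos.trans_le hx) hxy

theorem mapsTo_one_div_Ioc : MapsTo (fun K : ℝ => 1 / K) (Ioc 0 1) (Ici 1) :=
  fun _ hx => one_le_one_div hx.1 hx.2

theorem mapsTo_one_div_Ici : MapsTo (fun K : ℝ => 1 / K) (Ici 1) (Ioc 0 1) := fun _ hx =>
  ⟨one_div_pos.2 (one_pos.trans_le hx), (div_le_one (one_pos.trans_le hx)).2 hx⟩

section Inversion

variable {f g : ℝ → ℝ}

theorem strictMonoOn_Ioc_inversion (h : ∀ K, f K = g (1 / K)) :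
    StrictMonoOn f (Ioc 0 1) ↔ StrictAntiOn g (Ici 1) := by
  have hf : f = g ∘ fun K => 1 / K := funext h
  have hg : g = f ∘ fun K => 1 / K := funext fun K => by simp [h]
  refine ⟨fun H => ?_, fun H => ?_⟩
  · rw [hg]
    exact H.comp_strictAntiOn strictAntiOn_one_div_Ici mapsTo_one_div_Ici
  · rw [hf]
    exact H.comp strictAntiOn_one_div_Ioc mapsTo_one_div_Ioc

theorem strictAntiOn_Ioc_inversion (h : ∀ K, f K = g (1 / K)) :
    StrictAntiOn f (Ioc 0 1) ↔ StrictMonoOn g (Ici 1) := by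
  have hf : f = g ∘ fun K => 1 / K := funext h
  have hg : g = f ∘ fun K => 1 / K := funext fun K => by simp [h]
  refine ⟨fun H => ?_, fun H => ?_⟩
  · rw [hg]
    exact H.comp strictAntiOn_one_div_Ici mapsTo_one_div_Ici
  · rw [hf]
    exact H.comp_strictAntiOn strictAntiOn_one_div_Ioc mapsTo_one_div_Ioc

end Inversion

/-! ### Monotonicity of `g₇` -/

section

variable (ρ : ℝ → ℝ → ℝ) {a r p : ℝ}

theorem gSeven_of_lt_one (ha : a ∈ Ioo (0 : ℝ) 1) (hr : r ∈ Ioo (0 : ℝ) 1) (hp0 : 0 < p)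
    (hp : p < 1) :
    (StrictAntiOn (gSeven ρ a r p) (Ioc 0 1) ↔ ρ a r ≤ p * genM a r - genM a (r ^ p)) ∧
    (StrictMonoOn (gSeven ρ a r p) (Ici 1) ↔ p * genM a r - genM a (r ^ p) ≤ ρ a r) ∧
    (StrictAntiOn (gSeven ρ a r p) (Ici 1) ↔ ρ a r ≤ p * genMu a r - genMu a (r ^ p)) := by
  have h := decreasingElasticity_logGenMuInv ha
  have hrp := rpow_mem_Ioo hr hp0
  have hY := genMu_pos ha hr
  have hY' := genMu_pos ha hrp
  have hσ := logGenMuInv_genMu_rpow ha hr hrp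
  have hd := fun u (hu : 0 < u) => hasDerivAt_logGSeven (ρ := ρ a r) ha hr hp0 hu
  have hc := h.continuousAt_comparison_one (p := p) hY hY'
  have hIoc : ∀ u ∈ Ioc (0 : ℝ) 1, gSeven ρ a r p u = Real.exp (logGSeven a r p (ρ a r) u) :=
    fun u hu => gSeven_eq_exp ρ ha hr hp0 hu.1
  have hIci : ∀ u ∈ Ici (1 : ℝ), gSeven ρ a r p u = Real.exp (logGSeven a r p (ρ a r) u) :=
    fun u hu => gSeven_eq_exp ρ ha hr hp0 (one_pos.trans_le hu)
  rw [← comparison_one_eq ha hr hrp,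
    strictAntiOn_exp_comp_iff hIoc,
    strictMonoOn_exp_comp_iff hIci,
    strictAntiOn_exp_comp_iff hIci]
  exact ⟨strictAntiOn_Ioc_iff_le hd hc fun u hu => h.comparison_one_lt hp0 hp hY hY' hσ hu,
    strictMonoOn_Ici_iff_le hd hc fun u hu =>
      h.comparison_strictAntiOn hp0 hp hY hY' hσ self_mem_Ici hu.le hu,
    strictAntiOn_Ici_iff_le hd (h.tendsto_comparison hY hY') fun u hu =>
      h.lt_comparison hp0 hp hY hY' hσ hu⟩

theorem gSeven_of_one_lt (ha : a ∈ Ioo (0 : ℝ) 1) (hr : r ∈ Ioo (0 : ℝ) 1) (hp : 1 < p) :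
    (StrictMonoOn (gSeven ρ a r p) (Ioc 0 1) ↔ p * genM a r - genM a (r ^ p) ≤ ρ a r) ∧
    (StrictMonoOn (gSeven ρ a r p) (Ici 1) ↔ p * genMu a r - genMu a (r ^ p) ≤ ρ a r) ∧
    (StrictAntiOn (gSeven ρ a r p) (Ici 1) ↔ ρ a r ≤ p * genM a r - genM a (r ^ p)) := by
  have h := decreasingElasticity_logGenMuInv ha
  have hp0 : 0 < p := one_pos.trans hp
  have hrp := rpow_mem_Ioo hr hp0
  have hY := genMu_pos ha hr
  have hY' := genMu_pos ha hrp
  have hσ : logGenMuInv a (genMu a r) = p⁻¹ * logGenMuInv a (genMu a (r ^ p)) := by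
    rw [logGenMuInv_genMu_rpow ha hr hrp, inv_mul_cancel_left₀ hp0.ne']
  -- the criteria apply to `-log g₇`, with `-G` in place of `G`
  set G := comparison (fun y => hypH a (sqGenMuInv a y)) p (genMu a r) (genMu a (r ^ p)) with hG
  have hneg : ∀ u, -G u =
      p * comparison (fun y => hypH a (sqGenMuInv a y)) p⁻¹ (genMu a (r ^ p)) (genMu a r) u :=
    fun u => neg_comparison_eq _ hp0.ne' _ _ u
  have hd : ∀ u, 0 < u → HasDerivAt (-logGSeven a r p (ρ a r)) (-ρ a r - (-G) u) u :=
    fun u hu => (hasDerivAt_logGSeven ha hr hp0 hu).neg.congr_deriv (by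
      rw [Pi.neg_apply]
      ring)
  have hc : ContinuousAt (-G) 1 := (h.continuousAt_comparison_one hY hY').neg
  have hp1 : p⁻¹ < 1 := inv_lt_one_of_one_lt₀ hp
  have hp1' := inv_pos.2 hp0
  have hIoc : ∀ u ∈ Ioc (0 : ℝ) 1, gSeven ρ a r p u = Real.exp (logGSeven a r p (ρ a r) u) :=
    fun u hu => gSeven_eq_exp ρ ha hr hp0 hu.1
  have hIci : ∀ u ∈ Ici (1 : ℝ), gSeven ρ a r p u = Real.exp (logGSeven a r p (ρ a r) u) :=
    fun u hu => gSeven_eq_exp ρ ha hr hp0 (one_pos.trans_le hu)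
  rw [← comparison_one_eq ha hr hrp, ← hG,
    strictMonoOn_exp_comp_iff hIoc,
    strictMonoOn_exp_comp_iff hIci,
    strictAntiOn_exp_comp_iff hIci]
  have h1 := strictAntiOn_Ioc_iff_le hd hc fun u hu => by
    simp only [Pi.neg_apply, hneg]
    exact mul_lt_mul_of_pos_left (h.comparison_one_lt hp1' hp1 hY' hY hσ hu) hp0
  have h2 := strictAntiOn_Ici_iff_le (l := -(p * genMu a r - genMu a (r ^ p))) hd
    (h.tendsto_comparison hY hY').neg fun u hu => by
      have := mul_lt_mul_of_pos_left (h.lt_comparison hp1' hp1 hY' hY hσ hu) hp0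
      rw [← hneg, mul_sub, mul_inv_cancel_left₀ hp0.ne'] at this
      rw [Pi.neg_apply]
      linarith
  have h3 := strictMonoOn_Ici_iff_le hd hc fun u hu => by
    simp only [Pi.neg_apply, hneg]
    exact mul_lt_mul_of_pos_left
      (h.comparison_strictAntiOn hp1' hp1 hY' hY hσ self_mem_Ici hu.le hu) hp0
  simp only [Pi.neg_apply, neg_le_neg_iff] at h1 h2 h3
  refine ⟨?_, ?_, ?_⟩
  · rw [← h1]
    exact ⟨StrictMonoOn.neg, fun H => by simpa using H.neg⟩
  · rw [← h2]
    exact ⟨StrictMonoOn.neg, fun H => by simpa using H.neg⟩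
  · rw [← h3]
    exact ⟨StrictAntiOn.neg, fun H => by simpa using H.neg⟩

/-- For `p = 1` the function `g₇` is `u ↦ e ^ (ρ u)`. -/
theorem gSeven_of_eq_one (ha : a ∈ Ioo (0 : ℝ) 1) (hr : r ∈ Ioo (0 : ℝ) 1) :
    (StrictAntiOn (gSeven ρ a r 1) (Ioc 0 1) ↔ ρ a r < 0) ∧
    (StrictMonoOn (gSeven ρ a r 1) (Ici 1) ↔ 0 < ρ a r) ∧
    (StrictAntiOn (gSeven ρ a r 1) (Ici 1) ↔ ρ a r < 0) := by
  have hg : ∀ u, 0 < u → gSeven ρ a r 1 u = Real.exp (ρ a r * u) := fun u hu => by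
    rw [gSeven_eq_exp ρ ha hr one_pos hu, logGSeven, Real.rpow_one, one_mul, sub_self, sub_zero]
  have hIoc : ∀ u ∈ Ioc (0 : ℝ) 1, gSeven ρ a r 1 u = Real.exp (ρ a r * u) :=
    fun u hu => hg u hu.1
  have hIci : ∀ u ∈ Ici (1 : ℝ), gSeven ρ a r 1 u = Real.exp (ρ a r * u) :=
    fun u hu => hg u (one_pos.trans_le hu)
  rw [strictAntiOn_exp_comp_iff hIoc,
    strictMonoOn_exp_comp_iff hIci,
    strictAntiOn_exp_comp_iff hIci]
  refine ⟨⟨fun H => ?_, fun H x _ y _ hxy => mul_lt_mul_of_neg_left hxy H⟩,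
    ⟨fun H => ?_, fun H x _ y _ hxy => mul_lt_mul_of_pos_left hxy H⟩,
    ⟨fun H => ?_, fun H x _ y _ hxy => mul_lt_mul_of_neg_left hxy H⟩⟩
  · have := H (by norm_num : (1 / 2 : ℝ) ∈ Ioc (0 : ℝ) 1) (by norm_num : (1 : ℝ) ∈ Ioc (0 : ℝ) 1)
      (by norm_num)
    linarith
  · have := H (by norm_num : (1 : ℝ) ∈ Ici (1 : ℝ)) (by norm_num : (2 : ℝ) ∈ Ici (1 : ℝ))
      (by norm_num)
    linarith
  · have := H (by norm_num : (1 : ℝ) ∈ Ici (1 : ℝ)) (by norm_num : (2 : ℝ) ∈ Ici (1 : ℝ))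
      (by norm_num)
    linarith

end

theorem theorem6 (ξ ρ : ℝ → ℝ → ℝ) (a r p : ℝ)
    (ha : a ∈ Ioc (0 : ℝ) (1 / 2)) (hr : r ∈ Ioo (0 : ℝ) 1) (hp : 0 < p) :
    -- part (1)
    ((p < 1 →
        (StrictMonoOn (gSix ξ a r p) (Ioc 0 1) ↔ ξ a r ≤ p * genMu a r - genMu a (r ^ p)) ∧
        (StrictAntiOn (gSix ξ a r p) (Ioc 0 1) ↔ p * genM a r - genM a (r ^ p) ≤ ξ a r) ∧
        (StrictMonoOn (gSix ξ a r p) (Ici 1) ↔ ξ a r ≤ p * genM a r - genM a (r ^ p))) ∧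
      (p = 1 →
        (StrictMonoOn (gSix ξ a r p) (Ioc 0 1) ↔ ξ a r < p * genMu a r - genMu a (r ^ p)) ∧
        (StrictAntiOn (gSix ξ a r p) (Ioc 0 1) ↔ p * genM a r - genM a (r ^ p) < ξ a r) ∧
        (StrictMonoOn (gSix ξ a r p) (Ici 1) ↔ ξ a r < p * genM a r - genM a (r ^ p))) ∧
      (1 < p →
        (StrictMonoOn (gSix ξ a r p) (Ioc 0 1) ↔ ξ a r ≤ p * genM a r - genM a (r ^ p)) ∧
        (StrictAntiOn (gSix ξ a r p) (Ioc 0 1) ↔ p * genMu a r - genMu a (r ^ p) ≤ ξ a r) ∧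
        (StrictAntiOn (gSix ξ a r p) (Ici 1) ↔ p * genM a r - genM a (r ^ p) ≤ ξ a r))) ∧
    -- part (2)
    ((p < 1 →
        (StrictAntiOn (gSeven ρ a r p) (Ioc 0 1) ↔ ρ a r ≤ p * genM a r - genM a (r ^ p)) ∧
        (StrictMonoOn (gSeven ρ a r p) (Ici 1) ↔ p * genM a r - genM a (r ^ p) ≤ ρ a r) ∧
        (StrictAntiOn (gSeven ρ a r p) (Ici 1) ↔ ρ a r ≤ p * genMu a r - genMu a (r ^ p))) ∧
      (p = 1 →
        (StrictAntiOn (gSeven ρ a r p) (Ioc 0 1) ↔ ρ a r < p * genM a r - genM a (r ^ p)) ∧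
        (StrictMonoOn (gSeven ρ a r p) (Ici 1) ↔ p * genM a r - genM a (r ^ p) < ρ a r) ∧
        (StrictAntiOn (gSeven ρ a r p) (Ici 1) ↔ ρ a r < p * genMu a r - genMu a (r ^ p))) ∧
      (1 < p →
        (StrictMonoOn (gSeven ρ a r p) (Ioc 0 1) ↔ p * genM a r - genM a (r ^ p) ≤ ρ a r) ∧
        (StrictMonoOn (gSeven ρ a r p) (Ici 1) ↔ p * genMu a r - genMu a (r ^ p) ≤ ρ a r) ∧
        (StrictAntiOn (gSeven ρ a r p) (Ici 1) ↔ ρ a r ≤ p * genM a r - genM a (r ^ p)))) := by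
  have ha' : a ∈ Ioo (0 : ℝ) 1 := ⟨ha.1, ha.2.trans_lt (by norm_num)⟩
  rw [strictMonoOn_Ioc_inversion (gSix_eq_gSeven ξ a r p),
    strictAntiOn_Ioc_inversion (gSix_eq_gSeven ξ a r p),
    ← strictAntiOn_Ioc_inversion (f := gSeven ξ a r p) (g := gSix ξ a r p)
      fun K => by rw [gSix_eq_gSeven, one_div_one_div],
    ← strictMonoOn_Ioc_inversion (f := gSeven ξ a r p) (g := gSix ξ a r p)
      fun K => by rw [gSix_eq_gSeven, one_div_one_div]]
  refine ⟨⟨fun hp1 => ?_, ?_, fun hp1 => ?_⟩, fun hp1 => ?_, ?_, fun hp1 => ?_⟩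
  · obtain ⟨h1, h2, h3⟩ := gSeven_of_lt_one ξ ha' hr hp hp1
    exact ⟨h3, h2, h1⟩
  · rintro rfl
    obtain ⟨h1, h2, h3⟩ := gSeven_of_eq_one ξ ha' hr
    simp only [Real.rpow_one, one_mul, sub_self]
    exact ⟨h3, h2, h1⟩
  · obtain ⟨h1, h2, h3⟩ := gSeven_of_one_lt ξ ha' hr hp1
    exact ⟨h3, h2, h1⟩
  · exact gSeven_of_lt_one ρ ha' hr hp hp1
  · rintro rfl
    simpa only [Real.rpow_one, one_mul, sub_self] using gSeven_of_eq_one ρ ha' hr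
  · exact gSeven_of_one_lt ρ ha' hr hp1
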